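/- Let $T\in\mathbb N$, $d\in\mathbb N$, let $\Omega_1,\dots,\Omega_T$ be Polish spaces, put $\Omega^t:=\Omega_1\times\dots\times\Omega_t$ for $0\le t\le T$ ($\Omega^0$ is a singleton), let $\mathfrak P(X)$ be the set of Borel probability measures on a Polish space $X$ with the weak topology, and let $\mathcal B_c(X)$ be the universal $\sigma$-algebra of $X$. Let $S_t:\Omega^t\to\mathbb R^d$, $0\le t\le T$, be Borel measurable, and put $\Delta S_{t+1}(\omega^t,\omega_{t+1}):=S_{t+1}(\omega^t,\omega_{t+1})-S_t(\omega^t)$. For $0\le t\le T-1$ and $\omega^t\in\Omega^t$ let $\mathcal Q_{t+1}(\omega^t)\subset\mathfrak P(\Omega_{t+1})$ be non-empty and convex, and such that $\{(\omega^t,p):p\in\mathcal Q_{t+1}(\omega^t)\}$ is an analytic subset of $\Omega^t\times\mathfrak P(\Omega_{t+1})$. Let $\mathcal Q^t\subset\mathfrak P(\Omega^t)$ be the set of all products $q_1\otimes q_2\otimes\dots\otimes q_t$ in which $q_{s+1}$ is a universally measurable stochastic kernel on $\Omega_{s+1}$ given $\Omega^s$ with $q_{s+1}(\cdot,\omega^s)\in\mathcal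 Q_{s+1}(\omega^s)$ for all $\omega^s\in\Omega^s$ and $0\le s\le t-1$ (so $\mathcal Q^0$ consists of the Dirac measure). A property holds $\mathcal Q^t$-quasi-surely if the set where it fails is contained, for every $P\in\mathcal Q^t$, in a $P$-null set of $\mathcal B_c(\Omega^t)$. A strategy is a family $\phi=(\phi_t)_{1\le t\le T}$ of $\mathcal B_c(\Omega^{t-1})$-measurable maps $\phi_t:\Omega^{t-1}\to\mathbb R^d$, and $V_T^{0,\phi}:=\sum_{s=1}^T\phi_s\,\Delta S_s$ (scalar products). $NA(\mathcal Q^T)$ (respectively $NA(P)$, for $P\in\mathfrak P(\Omega^T)$) says that for every strategy $\phi$, if $V_T^{0,\phi}\ge 0$ $\mathcal Q^T$-quasi-surely (respectively $P$-a.s.), then $V_T^{0,\phi}=0$ $\mathcal Q^T$-quasi-surely (respectively $P$-a.s.). Suppose that there is $\widehat P\in\mathcal Q^T$ which dominates $\mathcal Q^T$, that is, $P\ll\widehat P$ for all $P\in\mathcal Q^T$. Then $$NA(\widehat P)\iff NA(\mathcal Q^T).$$ Moreover, if these equivalent conditions hold, then for every disintegration $\widehat P=\widehat p_1\otimes\dots\otimes\widehat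 p_T$ into universally measurable stochastic kernels and every $0\le t\le T-1$, $$D_{\widehat P}^{t+1}=D^{t+1}\quad\text{and}\quad 0\in\mathrm{Ri}\bigl(\mathrm{Conv}(D_{\widehat P}^{t+1})\bigr)\qquad\mathcal Q^t\text{-quasi-surely},$$ where $\mathrm{Ri}$ is the relative interior, $\mathrm{Conv}$ the convex hull, and $$D^{t+1}(\omega^t):=\bigcap\{A\subset\mathbb R^d\text{ closed}:\ p(\Delta S_{t+1}(\omega^t,\cdot)\in A)=1\ \text{for all }p\in\mathcal Q_{t+1}(\omega^t)\},$$ $$D_{\widehat P}^{t+1}(\omega^t):=\bigcap\{A\subset\mathbb R^d\text{ closed}:\ \widehat p_{t+1}(\Delta S_{t+1}(\omega^t,\cdot)\in A,\ \omega^t)=1\}.$$ -/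

import Mathlib

open MeasureTheory Set
open scoped RealInnerProductSpace

namespace QuasiSure

universe u v

section UniversalMeasurability

variable {X : Type u} {Y : Type v} [MeasurableSpace X] [MeasurableSpace Y]

/-- The universal sigma-algebra of a measurable space: the intersection of the completions of the
given sigma-algebra with respect to all probability measures. -/
abbrev univSigma (X : Type u) [MeasurableSpace X] : MeasurableSpace X where
  MeasurableSet' A := ∀ μ : Measure X, IsProbabilityMeasure μ → NullMeasurableSet A μ
  measurableSet_empty := fun _ _ => MeasurableSet.empty.nullMeasurableSet
  measurableSet_compl := fun _ hA μ hμ => (hA μ hμ).compl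
  measurableSet_iUnion := fun _ hA μ hμ => NullMeasurableSet.iUnion fun n => hA n μ hμ

/-- Universally measurable stochastic kernels `q(dy, x)` on `Y` given `X`. The sigma-algebra on
measures is the one generated by the evaluations at measurable sets. -/
def IsUnivKernel (q : X → ProbabilityMeasure Y) : Prop :=
  Measurable[univSigma X] fun x => (q x : Measure Y)

/-- A universally measurable kernel coincides almost everywhere with a measurable one. -/
theorem IsUnivKernel.aemeasurable [MeasurableSpace.CountablyGenerated Y]
    {q : X → ProbabilityMeasure Y} (hq : IsUnivKernel q) (P : Measure X) [IsProbabilityMeasure P] :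
    AEMeasurable (fun x => (q x : Measure Y)) P := by
  classical
  have key : ∀ B : Set Y, MeasurableSet B → AEMeasurable (fun x => (q x : Measure Y) B) P := by
    intro B hB
    have h1 : Measurable[univSigma X] fun x => (q x : Measure Y) B :=
      (Measure.measurable_coe hB).comp hq
    have h2 : NullMeasurable (fun x => (q x : Measure Y) B) P :=
      fun s hs => h1 hs P inferInstance
    exact h2.aemeasurable
  set C : Set (Set Y) := generateSetAlgebra (MeasurableSpace.countableGeneratingSet Y) with hC
  have hCc : C.Countable := countable_generateSetAlgebra
    MeasurableSpace.countable_countableGeneratingSet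
  have hCalg : IsSetAlgebra C := isSetAlgebra_generateSetAlgebra
  have hCg : MeasurableSpace.generateFrom C = ‹MeasurableSpace Y› := by
    rw [hC, generateFrom_generateSetAlgebra_eq, MeasurableSpace.generateFrom_countableGeneratingSet]
  have hCm : ∀ B ∈ C, MeasurableSet B := fun B hB => by
    have h := MeasurableSpace.measurableSet_generateFrom hB
    rwa [hCg] at h
  have hall : ∀ᵐ x ∂P, ∀ B, ∀ hB : B ∈ C,
      (q x : Measure Y) B = (key B (hCm B hB)).mk _ x :=
    (ae_ball_iff hCc).2 fun B hB => (key B (hCm B hB)).ae_eq_mk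
  obtain ⟨N, hN, hNm, hN0⟩ := exists_measurable_superset_of_null (ae_iff.1 hall)
  refine ⟨fun x => if x ∈ N then 0 else (q x : Measure Y), ?_, ?_⟩
  · have : ∀ x, IsFiniteMeasure (if x ∈ N then 0 else (q x : Measure Y)) := by
      intro x; split_ifs <;> infer_instance
    have hB : ∀ B ∈ C, Measurable fun x => (if x ∈ N then 0 else (q x : Measure Y)) B := by
      intro B hB
      have : (fun x => (if x ∈ N then 0 else (q x : Measure Y)) B)
          = fun x => if x ∈ N then 0 else (key B (hCm B hB)).mk _ x := by
        funext x
        by_cases hx : x ∈ N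
        · simp [hx]
        · simp only [hx, if_false]
          by_contra hne
          exact hx (hN (fun h => hne (h B hB)))
      rw [this]
      exact Measurable.ite hNm measurable_const (key B (hCm B hB)).measurable_mk
    exact Measurable.measure_of_isPiSystem hCg.symm
      (fun s hs t ht _ => hCalg.inter_mem hs ht) hB (hB _ hCalg.univ_mem)
  · have : ∀ᵐ x ∂P, x ∉ N := measure_eq_zero_iff_ae_notMem.1 hN0
    filter_upwards [this] with x hx
    simp [hx]

/-- Polar sets of a family `W` of probability measures. -/
def IsPolar (W : Set (ProbabilityMeasure X)) (N : Set X) : Prop :=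
  ∀ P ∈ W, ∃ A : Set X, MeasurableSet[univSigma X] A ∧ (P : Measure X) A = 0 ∧ N ⊆ A

/-- The property `p` holds `W`-quasi-surely: outside a `W`-polar set. -/
def QuasiSurely (W : Set (ProbabilityMeasure X)) (p : X → Prop) : Prop :=
  IsPolar W {x | ¬ p x}

end UniversalMeasurability

section Market

/-- `Hist Ω t` is the space `Ω^t` of scenarios up to time `t`; the type `Ω t` holds the scenarios
between times `t` and `t + 1`. `Hist Ω 0` is a singleton. -/
abbrev Hist (Ω : ℕ → Type u) (t : ℕ) : Type u := (i : Fin t) → Ω i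

/-- The scenario `(ω^t, y)` up to time `t + 1`. -/
def append {Ω : ℕ → Type u} {t : ℕ} (ω : Hist Ω t) (y : Ω t) : Hist Ω (t + 1) :=
  Fin.snoc (α := fun i : Fin (t + 1) => Ω i) ω y

/-- The restriction of a scenario up to time `t` to the first `s ≤ t` periods. -/
def restrict {Ω : ℕ → Type u} {s t : ℕ} (h : s ≤ t) (ω : Hist Ω t) : Hist Ω s :=
  fun i => ω (Fin.castLE h i)

variable {Ω : ℕ → Type u} [∀ t, MeasurableSpace (Ω t)]

/-- The measure `P ⊗ q` on `Ω^{t+1}`: `(P ⊗ q)(A) = ∫ q({y | (ω, y) ∈ A}, ω) P(dω)`. -/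
noncomputable def prodStep {t : ℕ} (P : Measure (Hist Ω t))
    (q : Hist Ω t → ProbabilityMeasure (Ω t)) : Measure (Hist Ω (t + 1)) :=
  P.bind fun ω => (q ω : Measure (Ω t)).map (append ω)

/-- The measure `q_1 ⊗ ⋯ ⊗ q_t` on `Ω^t`; the kernel `q s` (on `Ω s` given `Ω^s`) is written
`q_{s+1}` in the usual notation, and `q 0` is a probability measure as `Ω^0` is a singleton. -/
noncomputable def prodMeasure (q : (s : ℕ) → Hist Ω s → ProbabilityMeasure (Ω s)) :
    (t : ℕ) → Measure (Hist Ω t)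
  | 0 => Measure.dirac default
  | t + 1 => prodStep (prodMeasure q t) (q t)

theorem measurable_append {t : ℕ} :
    Measurable fun z : Hist Ω t × Ω t => append z.1 z.2 := by
  refine measurable_pi_lambda _ fun i => ?_
  refine Fin.lastCases ?_ (fun j => ?_) i
  · simpa [append] using measurable_snd
  · have h : Measurable fun z : Hist Ω t × Ω t => z.1 j :=
      (measurable_pi_apply j).comp measurable_fst
    simpa [append] using h

theorem measurable_append_right {t : ℕ} (ω : Hist Ω t) : Measurable (append ω) :=
  measurable_append.comp measurable_prodMk_left

theorem aemeasurable_map_append {t : ℕ} [MeasurableSpace.CountablyGenerated (Ω t)]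
    (P : Measure (Hist Ω t)) [IsProbabilityMeasure P]
    {q : Hist Ω t → ProbabilityMeasure (Ω t)} (hq : IsUnivKernel q) :
    AEMeasurable (fun ω => (q ω : Measure (Ω t)).map (append ω)) P := by
  classical
  have h := hq.aemeasurable P
  have hm := h.measurable_mk
  set g := h.mk _ with hg
  have hset : MeasurableSet {ω | g ω Set.univ = 1} :=
    ((Measure.measurable_coe MeasurableSet.univ).comp hm) (measurableSet_singleton 1)
  let κ : ProbabilityTheory.Kernel (Hist Ω t) (Ω t) :=
    ⟨fun ω => if g ω Set.univ = 1 then g ω else 0, Measurable.ite hset hm measurable_const⟩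
  have hκ : ∀ ω, κ ω = if g ω Set.univ = 1 then g ω else 0 := fun _ => rfl
  have : ProbabilityTheory.IsFiniteKernel κ := ⟨⟨1, ENNReal.one_lt_top, fun ω => by
    rw [hκ]; split_ifs with h1
    · exact h1.le
    · simp⟩⟩
  refine ⟨fun ω => (κ ω).map (append ω), ?_, ?_⟩
  · refine Measure.measurable_of_measurable_coe _ fun A hA => ?_
    have h2 : (fun ω => (κ ω).map (append ω) A)
        = fun ω => κ ω (Prod.mk ω ⁻¹' ((fun z => append z.1 z.2) ⁻¹' A)) := by
      funext ω
      rw [Measure.map_apply (measurable_append_right ω) hA]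
      rfl
    rw [h2]
    exact ProbabilityTheory.Kernel.measurable_kernel_prodMk_left (measurable_append hA)
  · filter_upwards [h.ae_eq_mk] with ω hω
    have h1 : g ω Set.univ = 1 := by
      rw [hg, ← hω]; exact measure_univ
    rw [hκ, if_pos h1, hω]

/-- The defining formula of `P ⊗ q` for a universally measurable kernel `q`. -/
theorem prodStep_apply {t : ℕ} [MeasurableSpace.CountablyGenerated (Ω t)]
    (P : Measure (Hist Ω t)) [IsProbabilityMeasure P]
    {q : Hist Ω t → ProbabilityMeasure (Ω t)} (hq : IsUnivKernel q)
    {A : Set (Hist Ω (t + 1))} (hA : MeasurableSet A) :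
    prodStep P q A = ∫⁻ ω, (q ω : Measure (Ω t)) {y | append ω y ∈ A} ∂P := by
  rw [prodStep, Measure.bind_apply hA (aemeasurable_map_append P hq)]
  refine lintegral_congr fun ω => ?_
  rw [Measure.map_apply (measurable_append_right ω) hA]
  rfl

/-- The set `𝒬^t` of priors up to time `t` built from the one-period sets of priors
`Q s ω ⊆ 𝔓(Ω s)`. -/
def priors (Q : (s : ℕ) → Hist Ω s → Set (ProbabilityMeasure (Ω s))) (t : ℕ) :
    Set (ProbabilityMeasure (Hist Ω t)) :=
  {P | ∃ q : (s : ℕ) → Hist Ω s → ProbabilityMeasure (Ω s),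
    (∀ s < t, IsUnivKernel (q s) ∧ ∀ ω, q s ω ∈ Q s ω) ∧
    (P : Measure (Hist Ω t)) = prodMeasure q t}

variable {d : ℕ}

/-- The price increment `ΔS_{t+1}(ω^t, y)`. -/
noncomputable def incr (S : (t : ℕ) → Hist Ω t → EuclideanSpace ℝ (Fin d)) (t : ℕ)
    (ω : Hist Ω t) (y : Ω t) : EuclideanSpace ℝ (Fin d) :=
  S (t + 1) (append ω y) - S t ω

/-- Trading strategies up to the horizon `T`: `φ t` is the universally measurable vector of holdings
between times `t` and `t + 1`, chosen at time `t`. -/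
def IsStrategy (T : ℕ) (φ : (t : ℕ) → Hist Ω t → EuclideanSpace ℝ (Fin d)) : Prop :=
  ∀ t < T, Measurable[univSigma (Hist Ω t)] (φ t)

/-- The value `V_t^{x,φ}` at time `t` of the self-financing portfolio `φ` with initial capital `x`. -/
noncomputable def wealth (S : (t : ℕ) → Hist Ω t → EuclideanSpace ℝ (Fin d)) (x : ℝ)
    (φ : (t : ℕ) → Hist Ω t → EuclideanSpace ℝ (Fin d)) (t : ℕ) (ω : Hist Ω t) : ℝ :=
  x + ∑ s : Fin t, ⟪φ s.val (restrict s.isLt.le ω),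
    S (s.val + 1) (restrict (Nat.succ_le_of_lt s.isLt) ω) - S s.val (restrict s.isLt.le ω)⟫

/-- The quasi-sure no-arbitrage condition `NA(W)` with horizon `T`. -/
def NoArbitrage (S : (t : ℕ) → Hist Ω t → EuclideanSpace ℝ (Fin d)) (T : ℕ)
    (W : Set (ProbabilityMeasure (Hist Ω T))) : Prop :=
  ∀ φ : (t : ℕ) → Hist Ω t → EuclideanSpace ℝ (Fin d), IsStrategy T φ →
    QuasiSurely W (fun ω => 0 ≤ wealth S 0 φ T ω) →
    QuasiSurely W (fun ω => wealth S 0 φ T ω = 0)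

/-- The one-prior no-arbitrage condition `NA(P)` with horizon `T`. -/
def NoArbitrageFor (S : (t : ℕ) → Hist Ω t → EuclideanSpace ℝ (Fin d)) (T : ℕ)
    (P : ProbabilityMeasure (Hist Ω T)) : Prop :=
  ∀ φ : (t : ℕ) → Hist Ω t → EuclideanSpace ℝ (Fin d), IsStrategy T φ →
    (∀ᵐ ω ∂(P : Measure (Hist Ω T)), 0 ≤ wealth S 0 φ T ω) →
    (∀ᵐ ω ∂(P : Measure (Hist Ω T)), wealth S 0 φ T ω = 0)

/-- The quasi-sure conditional support `D^{t+1}(ω^t)` of the price increment. -/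
def condSupport (S : (t : ℕ) → Hist Ω t → EuclideanSpace ℝ (Fin d))
    (Q : (t : ℕ) → Hist Ω t → Set (ProbabilityMeasure (Ω t))) (t : ℕ) (ω : Hist Ω t) :
    Set (EuclideanSpace ℝ (Fin d)) :=
  ⋂₀ {A | IsClosed A ∧ ∀ p ∈ Q t ω, (p : Measure (Ω t)) {y | incr S t ω y ∈ A} = 1}

/-- The conditional support `D_P^{t+1}(ω^t)` of the price increment, for `P` with the fixed
disintegration `P = q_1 ⊗ ⋯ ⊗ q_T`. -/
def condSupportFor (S : (t : ℕ) → Hist Ω t → EuclideanSpace ℝ (Fin d))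
    (q : (t : ℕ) → Hist Ω t → ProbabilityMeasure (Ω t)) (t : ℕ) (ω : Hist Ω t) :
    Set (EuclideanSpace ℝ (Fin d)) :=
  ⋂₀ {A | IsClosed A ∧ (q t ω : Measure (Ω t)) {y | incr S t ω y ∈ A} = 1}

end Market

end QuasiSure

/-!
The dominating prior `P̂` belongs to the family `𝒬^T` and dominates it, so a property holds
`𝒬^T`-quasi-surely if and only if it holds `P̂`-almost surely; this makes the two no-arbitrage
conditions equivalent (`noArbitrageFor_iff_of_dominating`). The domination passes to the marginals,
since every prior up to time `t` extends to one up to time `T`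
(`absolutelyContinuous_prodMeasure`), and disintegrations are almost surely unique
(`ae_eq_of_prodStep_eq`). It is therefore enough to prove the statements on supports almost surely
for the marginal of `P̂` at time `t` and for a disintegration `q` of `P̂` with values in the
one-period sets of priors.

For the equality of the supports, fix a basic open set `U`. If, on a set of scenarios of positive
measure, `q` gives no mass to `ΔS ∈ U` but some one-period prior does, such a prior can be selected
measurably; using it in place of `q` on a set of positive measure yields an element of `𝒬^{t+1}`
which is not dominated (`ae_null_of_dominated`). In the same way, if on a set of positive measure
some direction `ξ` makes `⟪ξ, ΔS⟫` conditionally non-negative and non-zero, a measurable selection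
of such directions is an arbitrage over one period (`ae_noArbitrage_of_prodStep`). When no such
direction exists, separation of convex sets in finite dimension puts `0` in the relative interior
of the convex hull of the support (`zero_mem_intrinsicInterior_convexHull`).

Both selections come from `exists_measurable_selection_of_analyticSet`. Since the kernel can be left
unchanged elsewhere, a Borel selector on one Borel set of positive measure suffices. An analytic
set is a continuous image of the Baire space; by capacitability its projection contains the image
of a compact set with positive measure, over which minimizing an injective continuous function
along the fibres gives a Borel section.
-/

namespace QuasiSure

/-! ### Measurable selection on a set of positive measure -/

theorem continuous_cantorFunction {c : ℝ} (h0 : 0 ≤ c) (h1 : c < 1) :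
    Continuous (Cardinal.cantorFunction c) := by
  refine continuous_tsum (u := fun n => c ^ n) (fun n => ?_)
    (summable_geometric_of_lt_one h0 h1) fun n f => ?_
  · exact (continuous_of_discreteTopology (f := fun b : Bool => cond b (c ^ n) 0)).comp
      (continuous_apply n)
  · rw [Real.norm_of_nonneg (Cardinal.cantorFunctionAux_nonneg h0)]
    cases h : f n <;> simp [Cardinal.cantorFunctionAux, h, pow_nonneg h0 n]

/-- The Baire space embeds continuously into the line: code a sequence by the characteristic
function of its graph. -/
theorem exists_continuous_injective_baire_real :
    ∃ h : (ℕ → ℕ) → ℝ, Continuous h ∧ Function.Injective h := by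
  let e : (ℕ → ℕ) → ℕ → Bool := fun α k => decide (α (Nat.unpair k).1 = (Nat.unpair k).2)
  have he : Continuous e := continuous_pi fun k =>
    (continuous_of_discreteTopology (f := fun m : ℕ => decide (m = (Nat.unpair k).2))).comp
      (continuous_apply _)
  refine ⟨Cardinal.cantorFunction (1 / 3) ∘ e,
    (continuous_cantorFunction (by norm_num) (by norm_num)).comp he,
    (Cardinal.cantorFunction_injective (by norm_num) (by norm_num)).comp fun α β h => ?_⟩
  funext i
  have := congrFun h (Nat.pair i (α i))
  simpa [e, eq_comm] using this

/-- Capacitability of analytic sets: a continuous image of the Baire space of positive outer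
measure contains the image of a compact set with positive measure. The outer measure is continuous
along increasing sequences of arbitrary sets, so the coordinates can be bounded one after the
other at a small loss of measure. -/
theorem exists_isCompact_measure_image_ne_zero {X : Type*} [TopologicalSpace X]
    [TopologicalSpace.PseudoMetrizableSpace X] [MeasurableSpace X] [BorelSpace X]
    (μ : Measure X) [IsFiniteMeasure μ] {g : (ℕ → ℕ) → X} (hg : Continuous g)
    (h : μ (range g) ≠ 0) : ∃ L : Set (ℕ → ℕ), IsCompact L ∧ μ (g '' L) ≠ 0 := by
  classical
  set c := μ (range g) / 2
  have hc : c < μ (range g) := ENNReal.half_lt_self h (measure_ne_top _ _)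
  have step : ∀ (A : Set (ℕ → ℕ)) (k : ℕ), c < μ (g '' A) →
      ∃ n, c < μ (g '' (A ∩ {α | α k ≤ n})) := by
    intro A k hA
    have hU : g '' A = ⋃ n, g '' (A ∩ {α | α k ≤ n}) := by
      rw [← image_iUnion, ← inter_iUnion]
      congr 1
      ext α
      simp only [mem_inter_iff, mem_iUnion, mem_ofPred_eq]
      exact ⟨fun h => ⟨h, α k, le_rfl⟩, fun h => h.1⟩
    have hm : Monotone fun n => g '' (A ∩ {α | α k ≤ n}) := fun m n hmn =>
      image_mono (inter_subset_inter_right _ fun α (hα : α k ≤ m) => hα.trans hmn)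
    rw [hU, hm.measure_iUnion] at hA
    exact lt_iSup_iff.1 hA
  let A : ℕ → {A : Set (ℕ → ℕ) // c < μ (g '' A)} := fun n =>
    Nat.rec ⟨univ, by rwa [image_univ]⟩
      (fun k A => ⟨A.1 ∩ {α | α k ≤ (step A.1 k A.2).choose}, (step A.1 k A.2).choose_spec⟩) n
  let b : ℕ → ℕ := fun k => (step (A k).1 k (A k).2).choose
  have hA : ∀ k α, α ∈ (A k).1 ↔ ∀ i < k, α i ≤ b i := by
    intro k
    induction k with
    | zero => intro α; simp [A]
    | succ k ih =>
      intro α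
      have : (A (k + 1)).1 = (A k).1 ∩ {α | α k ≤ b k} := rfl
      rw [this, mem_inter_iff, ih, Nat.forall_lt_succ_right]
      rfl
  have hL : IsCompact (univ.pi fun k => Iic (b k)) :=
    isCompact_univ_pi fun k => (finite_Iic (b k)).isCompact
  refine ⟨_, hL, fun h0 => ?_⟩
  have hle : c ≤ μ (g '' univ.pi fun k => Iic (b k)) := by
    rw [measure_eq_iInf_isOpen]
    refine le_iInf₂ fun U hU => le_iInf fun hUo => ?_
    let : MetricSpace (ℕ → ℕ) := PiNat.metricSpaceNatNat
    obtain ⟨δ, hδ, hδU⟩ := hL.exists_thickening_subset_open (hUo.preimage hg)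
      (image_subset_iff.1 hU)
    obtain ⟨k, hk⟩ := exists_pow_lt_of_lt_one hδ (by norm_num : (1 / 2 : ℝ) < 1)
    refine (A k).2.le.trans (measure_mono ?_)
    rw [image_subset_iff]
    intro α hα
    rw [hA] at hα
    refine hδU (Metric.mem_thickening_iff.2 ⟨fun i => min (α i) (b i), fun i _ => ?_, ?_⟩)
    · exact min_le_right (α i) (b i)
    · refine lt_of_le_of_lt (PiNat.mem_cylinder_iff_dist_le.1 ?_) hk
      intro i hi
      exact (min_eq_left (hα i hi)).symm
  rw [h0, nonpos_iff_eq_zero, ENNReal.div_eq_zero_iff] at hle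
  exact hle.elim h (by simp)

/-- On a set of positive measure, a continuous image of the Baire space has a Borel section. On the
compact set provided by capacitability, the section minimizes an injective continuous function
along the fibres; the minimum is Borel because its sublevel sets are compact. -/
theorem exists_measurable_section {X : Type*} [TopologicalSpace X]
    [TopologicalSpace.MetrizableSpace X] [MeasurableSpace X] [BorelSpace X]
    (μ : Measure X) [IsFiniteMeasure μ] {g : (ℕ → ℕ) → X} (hg : Continuous g)
    (h : μ (range g) ≠ 0) : ∃ K : Set X, MeasurableSet K ∧ μ K ≠ 0 ∧
      ∃ σ : X → ℕ → ℕ, Measurable σ ∧ ∀ x ∈ K, g (σ x) = x := by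
  obtain ⟨L, hL, hL0⟩ := exists_isCompact_measure_image_ne_zero μ hg h
  obtain ⟨e, he, hinj⟩ := exists_continuous_injective_baire_real
  have hemb : MeasurableEmbedding e := he.measurableEmbedding hinj
  have hcpt : ∀ F : Set (ℕ → ℕ), IsClosed F → MeasurableSet (g '' (L ∩ F)) := fun F hF =>
    ((hL.inter_right hF).image hg).isClosed.measurableSet
  have hK : MeasurableSet (g '' L) := by simpa using hcpt univ isClosed_univ
  let m : X → ℝ := fun x => sInf (e '' (L ∩ g ⁻¹' {x}))
  have hmem : ∀ x ∈ g '' L, m x ∈ e '' (L ∩ g ⁻¹' {x}) := by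
    rintro x ⟨α, hα, rfl⟩
    exact ((hL.inter_right (isClosed_singleton.preimage hg)).image he).sInf_mem
      ⟨_, α, ⟨hα, rfl⟩, rfl⟩
  have hm : Measurable m := by
    refine measurable_of_Iic fun r => ?_
    have : m ⁻¹' Iic r = g '' (L ∩ e ⁻¹' Iic r) ∪ ((g '' L)ᶜ ∩ {_x | (0 : ℝ) ≤ r}) := by
      ext x
      by_cases hx : x ∈ g '' L
      · simp only [mem_preimage, mem_Iic, mem_union, mem_inter_iff, mem_compl_iff, hx,
          not_true_eq_false, false_and, or_false]
        constructor
        · intro hr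
          obtain ⟨α, ⟨hα, hαx⟩, hαm⟩ := hmem x hx
          exact ⟨α, ⟨hα, by simpa [hαm] using hr⟩, hαx⟩
        · rintro ⟨α, ⟨hα, hαr⟩, hαx⟩
          refine le_trans (csInf_le ?_ ⟨α, ⟨hα, hαx⟩, rfl⟩) hαr
          exact (((hL.inter_right (isClosed_singleton.preimage hg)).image he).isBounded).bddBelow
      · -- off the image of `L` the fibre is empty and `sInf ∅ = 0`
        have hemp : L ∩ g ⁻¹' {x} = ∅ := by
          ext α
          simp only [mem_inter_iff, mem_preimage, mem_singleton_iff, mem_empty_iff_false,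
            iff_false, not_and]
          exact fun hα hαx => hx ⟨α, hα, hαx⟩
        have hx' : x ∉ g '' (L ∩ e ⁻¹' Iic r) := fun h => hx (image_mono inter_subset_left h)
        simp [m, hemp, hx', hx]
    rw [this]
    exact (hcpt _ (isClosed_Iic.preimage he)).union (hK.compl.inter (MeasurableSet.const _))
  refine ⟨g '' L, hK, hL0, fun x => hemb.invFun (m x), hemb.measurable_invFun.comp hm, ?_⟩
  intro x hx
  obtain ⟨α, ⟨_, hαx⟩, hαm⟩ := hmem x hx
  simp only [← hαm, hemb.leftInverse_invFun α]
  exact hαx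

/-- Measurable selection from an analytic set: if its projection has positive outer measure, it
contains the graph of a Borel function on some Borel set of positive measure. -/
theorem exists_measurable_selection_of_analyticSet {X Z : Type*} [TopologicalSpace X]
    [TopologicalSpace.MetrizableSpace X] [MeasurableSpace X] [BorelSpace X]
    [TopologicalSpace Z] (μ : Measure X) [IsFiniteMeasure μ] {A : Set (X × Z)}
    (hA : AnalyticSet A) (h : μ (Prod.fst '' A) ≠ 0) :
    ∃ K : Set X, MeasurableSet K ∧ μ K ≠ 0 ∧
      ∃ σ : X → Z, Measurable[_, borel Z] σ ∧ ∀ x ∈ K, (x, σ x) ∈ A := by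
  rw [AnalyticSet] at hA
  obtain rfl | ⟨f, hf, rfl⟩ := hA
  · simp at h
  rw [← range_comp] at h
  obtain ⟨K, hK, hK0, σ, hσ, hσK⟩ := exists_measurable_section μ (continuous_fst.comp hf) h
  refine ⟨K, hK, hK0, fun x => (f (σ x)).2, ?_, fun x hx => ⟨σ x, ?_⟩⟩
  · let : MeasurableSpace Z := borel Z
    have : BorelSpace Z := ⟨rfl⟩
    exact (continuous_snd.comp hf).measurable.comp hσ
  · exact Prod.ext (hσK x hx) rfl

/-- The evaluations at Borel sets are Borel functions for the weak topology. -/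
theorem measurable_coe_probabilityMeasure_of_borel {Y : Type*} [TopologicalSpace Y] [PolishSpace Y]
    [MeasurableSpace Y] [BorelSpace Y] :
    Measurable[borel (ProbabilityMeasure Y)] fun p : ProbabilityMeasure Y => (p : Measure Y) := by
  let : MeasurableSpace (ProbabilityMeasure Y) := borel _
  have : BorelSpace (ProbabilityMeasure Y) := ⟨rfl⟩
  refine Measurable.measure_of_isPiSystem_of_isProbabilityMeasure
    (BorelSpace.measurable_eq (α := Y)) (S := {s | IsOpen s})
    (fun s hs t ht _ => IsOpen.inter hs ht) fun U hU => ?_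
  refine LowerSemicontinuous.measurable (lowerSemicontinuous_iff_le_liminf.2 fun p => ?_)
  let := TopologicalSpace.upgradeIsCompletelyMetrizable Y
  exact ProbabilityMeasure.le_liminf_measure_open_of_tendsto Filter.tendsto_id hU

/-! ### Zero in the relative interior of a convex hull -/

section Convex
variable {E : Type*} [NormedAddCommGroup E] [InnerProductSpace ℝ E] [FiniteDimensional ℝ E]

theorem zero_mem_interior_convexHull_of_span_eq_top {D : Set E} (hne : D.Nonempty)
    (hspan : Submodule.span ℝ D = ⊤)
    (h : ∀ ξ : E, (∀ x ∈ D, 0 ≤ ⟪ξ, x⟫) → ∀ x ∈ D, ⟪ξ, x⟫ = 0) :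
    (0 : E) ∈ interior (convexHull ℝ D) := by
  have h' : ∀ f : E →L[ℝ] ℝ, (∀ x ∈ D, 0 ≤ f x) → ∀ x ∈ D, f x = 0 := by
    intro f
    simpa using h ((InnerProductSpace.toDual ℝ E).symm f)
  have hsub : D ⊆ affineSpan ℝ D := subset_affineSpan ℝ D
  have h0 : (0 : E) ∈ affineSpan ℝ D := by
    by_contra h0
    obtain ⟨f, u, hu, hf⟩ := geometric_hahn_banach_point_closed
      (AffineSubspace.convex (affineSpan ℝ D))
      (AffineSubspace.closed_of_finiteDimensional (affineSpan ℝ D)) h0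
    rw [map_zero] at hu
    obtain ⟨x, hx⟩ := hne
    have := h' f (fun y hy => (hu.trans (hf y (hsub hy))).le) x hx
    linarith [hf x (hsub hx)]
  have htop : affineSpan ℝ D = ⊤ := by
    rw [← AffineSubspace.direction_eq_top_iff_of_nonempty ⟨0, h0⟩, eq_top_iff, ← hspan,
      Submodule.span_le]
    intro x hx
    simpa using AffineSubspace.vsub_mem_direction (hsub hx) h0
  have hint : (interior (convexHull ℝ D)).Nonempty :=
    interior_convexHull_nonempty_iff_affineSpan_eq_top.2 htop
  by_contra hn
  obtain ⟨f, hf⟩ := geometric_hahn_banach_open_point (convex_convexHull ℝ D).interior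
    isOpen_interior hn
  rw [map_zero] at hf
  have hle : ∀ x ∈ D, f x ≤ 0 := by
    intro x hx
    have hcl : x ∈ closure (interior (convexHull ℝ D)) := by
      rw [(convex_convexHull ℝ D).closure_interior_eq_closure_of_nonempty_interior hint]
      exact subset_closure (subset_convexHull ℝ D hx)
    exact closure_minimal (fun y hy => (hf y hy).le)
      (isClosed_le f.continuous continuous_const) hcl
  have hz : ∀ x ∈ D, f x = 0 := fun x hx => by
    simpa using h' (-f) (fun y hy => by simpa using hle y hy) x hx
  obtain ⟨y, hy⟩ := hint
  have hyz : y ∈ {z : E | f z = 0} := convexHull_min hz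
    (convex_hyperplane f.toLinearMap.isLinear 0) (interior_subset hy)
  exact (hf y hy).ne hyz

/-- If no linear functional is non-negative and non-zero on `D`, then `0` lies in the relative
interior of the convex hull of `D`. -/
theorem zero_mem_intrinsicInterior_convexHull {D : Set E} (hne : D.Nonempty)
    (h : ∀ ξ : E, (∀ x ∈ D, 0 ≤ ⟪ξ, x⟫) → ∀ x ∈ D, ⟪ξ, x⟫ = 0) :
    (0 : E) ∈ intrinsicInterior ℝ (convexHull ℝ D) := by
  set M := Submodule.span ℝ D
  let s : Set M := Subtype.val ⁻¹' D
  have hs : Subtype.val '' s = D :=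
    (Subtype.image_preimage_coe (M : Set E) D).trans (inter_eq_right.2 Submodule.subset_span)
  have hM : (0 : M) ∈ interior (convexHull ℝ s) := by
    refine zero_mem_interior_convexHull_of_span_eq_top ?_ (Submodule.span_span_coe_preimage)
      fun ξ hξ x hx => ?_
    · rw [← hs] at hne
      exact hne.of_image
    · exact h ξ (fun y hy => hξ ⟨y, Submodule.subset_span hy⟩ hy) x hx
  have himg : convexHull ℝ D = M.subtypeₗᵢ.toAffineIsometry '' convexHull ℝ s := by
    have := (M.subtype).image_convexHull s
    rw [Submodule.coe_subtype, hs] at this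
    exact this.symm
  rw [himg, AffineIsometry.intrinsicInterior_image]
  exact ⟨0, interior_subset_intrinsicInterior hM, rfl⟩

end Convex

/-! ### Product measures, their marginals and their null sets -/

theorem restrict_append {Ω : ℕ → Type*} {s t : ℕ} (h : s ≤ t) (ω : Hist Ω t) (y : Ω t) :
    restrict (h.trans t.le_succ) (append ω y) = restrict h ω := by
  funext i
  exact Fin.snoc_castSucc (α := fun i : Fin (t + 1) => Ω i) y ω (Fin.castLE h i)

section Products
variable {Ω : ℕ → Type*} [∀ t, MeasurableSpace (Ω t)]

theorem measurable_restrict {s t : ℕ} (h : s ≤ t) : Measurable (restrict (Ω := Ω) h) :=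
  measurable_pi_lambda _ fun i => measurable_pi_apply (Fin.castLE h i)

theorem le_univSigma {X : Type*} [m : MeasurableSpace X] : m ≤ univSigma X :=
  fun _ hs _ _ => MeasurableSet.nullMeasurableSet hs

/-- A version of `IsUnivKernel.aemeasurable` whose Borel modification is a Markov kernel
everywhere. -/
theorem IsUnivKernel.exists_kernel {X Y : Type*} [MeasurableSpace X] [MeasurableSpace Y]
    [MeasurableSpace.CountablyGenerated Y] {q : X → ProbabilityMeasure Y} (hq : IsUnivKernel q)
    (P : Measure X) [IsProbabilityMeasure P] :
    ∃ κ : ProbabilityTheory.Kernel X Y, ProbabilityTheory.IsMarkovKernel κ ∧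
      ∀ᵐ x ∂P, (q x : Measure Y) = κ x := by
  classical
  have h := hq.aemeasurable P
  have hm := h.measurable_mk
  have hset : MeasurableSet {x | h.mk _ x univ = 1} :=
    ((Measure.measurable_coe MeasurableSet.univ).comp hm) (measurableSet_singleton 1)
  obtain ⟨x₀⟩ : Nonempty X := nonempty_of_isProbabilityMeasure P
  let κ : ProbabilityTheory.Kernel X Y :=
    ⟨fun x => if h.mk _ x univ = 1 then h.mk _ x else q x₀, Measurable.ite hset hm measurable_const⟩
  have hκ : ∀ x, κ x = if h.mk _ x univ = 1 then h.mk _ x else (q x₀ : Measure Y) := fun _ => rfl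
  refine ⟨κ, ⟨fun x => ?_⟩, ?_⟩
  · rw [hκ]
    split_ifs with h1
    · exact ⟨h1⟩
    · infer_instance
  · filter_upwards [h.ae_eq_mk] with x hx
    rw [hκ, if_pos (by rw [← hx]; exact measure_univ), hx]

theorem prodMeasure_congr {q q' : (s : ℕ) → Hist Ω s → ProbabilityMeasure (Ω s)}
    {t : ℕ} (h : ∀ s < t, q s = q' s) : prodMeasure q t = prodMeasure q' t := by
  induction t with
  | zero => rfl
  | succ t ih =>
    rw [prodMeasure, prodMeasure, ih fun s hs => h s (hs.trans t.lt_succ_self),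
      h t t.lt_succ_self]

variable [∀ t, MeasurableSpace.CountablyGenerated (Ω t)]

theorem isProbabilityMeasure_prodStep {t : ℕ} (P : Measure (Hist Ω t)) [IsProbabilityMeasure P]
    {q : Hist Ω t → ProbabilityMeasure (Ω t)} (hq : IsUnivKernel q) :
    IsProbabilityMeasure (prodStep P q) :=
  ⟨by simp [prodStep_apply P hq MeasurableSet.univ]⟩

/-- A set is null for `P ⊗ q` if and only if almost all of its sections are null. -/
theorem prodStep_eq_zero_iff {t : ℕ} (P : Measure (Hist Ω t)) [IsProbabilityMeasure P]
    {q : Hist Ω t → ProbabilityMeasure (Ω t)} (hq : IsUnivKernel q)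
    {A : Set (Hist Ω (t + 1))} (hA : MeasurableSet A) :
    prodStep P q A = 0 ↔ ∀ᵐ ω ∂P, (q ω : Measure (Ω t)) {y | append ω y ∈ A} = 0 := by
  obtain ⟨κ, hκ, hqκ⟩ := hq.exists_kernel P
  rw [prodStep_apply P hq hA, lintegral_eq_zero_iff']
  · rfl
  · refine ⟨fun ω => κ ω {y | append ω y ∈ A}, ?_, ?_⟩
    · exact ProbabilityTheory.Kernel.measurable_kernel_prodMk_left (measurable_append hA)
    · filter_upwards [hqκ] with ω hω
      rw [hω]

theorem isProbabilityMeasure_prodMeasure {q : (s : ℕ) → Hist Ω s → ProbabilityMeasure (Ω s)}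
    {t : ℕ} (hq : ∀ s < t, IsUnivKernel (q s)) : IsProbabilityMeasure (prodMeasure q t) := by
  induction t with
  | zero => exact Measure.dirac.isProbabilityMeasure
  | succ t ih =>
    have := ih fun s hs => hq s (hs.trans t.lt_succ_self)
    exact isProbabilityMeasure_prodStep _ (hq t t.lt_succ_self)

/-- The marginals of a product of kernels are the partial products. -/
theorem map_restrict_prodMeasure {q : (s : ℕ) → Hist Ω s → ProbabilityMeasure (Ω s)} {t T : ℕ}
    (h : t ≤ T) (hq : ∀ s < T, IsUnivKernel (q s)) :
    (prodMeasure q T).map (restrict h) = prodMeasure q t := by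
  induction T, h using Nat.le_induction with
  | base => exact Measure.map_id
  | succ T h ih =>
    have hq' : ∀ s < T, IsUnivKernel (q s) := fun s hs => hq s (hs.trans T.lt_succ_self)
    have := isProbabilityMeasure_prodMeasure hq'
    rw [← ih hq']
    ext A hA
    rw [Measure.map_apply (measurable_restrict _) hA, Measure.map_apply (measurable_restrict _) hA,
      prodMeasure, prodStep_apply _ (hq T T.lt_succ_self) (measurable_restrict _ hA),
      ← lintegral_indicator_one (measurable_restrict h hA)]
    refine lintegral_congr fun ω => ?_
    simp only [mem_preimage, restrict_append h]
    by_cases hω : restrict h ω ∈ A <;> simp [hω]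

/-- Disintegrations are unique: if `P ⊗ q = P ⊗ q'`, then `q = q'` almost surely. -/
theorem ae_eq_of_prodStep_eq {t : ℕ} (P : Measure (Hist Ω t)) [IsProbabilityMeasure P]
    {q q' : Hist Ω t → ProbabilityMeasure (Ω t)} (hq : IsUnivKernel q) (hq' : IsUnivKernel q')
    (h : prodStep P q = prodStep P q') : ∀ᵐ ω ∂P, q ω = q' ω := by
  have key : ∀ (r : Hist Ω t → ProbabilityMeasure (Ω t)) (κ : ProbabilityTheory.Kernel _ _),
      IsUnivKernel r → ProbabilityTheory.IsMarkovKernel κ → (∀ᵐ ω ∂P, (r ω : Measure (Ω t)) = κ ω) →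
      (prodStep P r).map (fun ω => (restrict t.le_succ ω, ω (Fin.last t))) = P.compProd κ := by
    intro r κ hr hκ hrκ
    have hm : Measurable fun ω : Hist Ω (t + 1) => (restrict t.le_succ ω, ω (Fin.last t)) :=
      (measurable_restrict _).prodMk (measurable_pi_apply _)
    ext A hA
    rw [Measure.map_apply hm hA, prodStep_apply _ hr (hm hA), Measure.compProd_apply hA]
    refine lintegral_congr_ae ?_
    filter_upwards [hrκ] with ω hω
    rw [hω]
    congr 1
    ext y
    have h1 : append ω y (Fin.last t) = y :=
      Fin.snoc_last (α := fun i : Fin (t + 1) => Ω i) y ω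
    have h2 : restrict t.le_succ (append ω y) = ω := restrict_append le_rfl ω y
    simp only [mem_ofPred_eq, mem_preimage, h1, h2]
  obtain ⟨κ, hκ, hqκ⟩ := hq.exists_kernel P
  obtain ⟨κ', hκ', hqκ'⟩ := hq'.exists_kernel P
  have hcomp : P.compProd κ = P.compProd κ' := by
    rw [← key q κ hq hκ hqκ, ← key q' κ' hq' hκ' hqκ', h]
  filter_upwards [hqκ, hqκ', ProbabilityTheory.Kernel.ae_eq_of_compProd_eq hcomp] with ω h1 h2 h3
  exact Subtype.ext (h1.trans (h3.trans h2.symm))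

end Products

/-! ### Quasi-sure properties and the dominating prior -/

theorem quasiSurely_iff_ae {X : Type*} [MeasurableSpace X] {W : Set (ProbabilityMeasure X)}
    {p : X → Prop} : QuasiSurely W p ↔ ∀ P ∈ W, ∀ᵐ x ∂(P : Measure X), p x := by
  refine forall₂_congr fun P _ => ⟨fun ⟨A, _, hA0, hA⟩ => measure_mono_null hA hA0, fun h => ?_⟩
  exact ⟨_, le_univSigma _ (measurableSet_toMeasurable _ _),
    (measure_toMeasurable _).trans h, subset_toMeasurable _ _⟩

section Priors
variable {Ω : ℕ → Type*} [∀ t, MeasurableSpace (Ω t)]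
  [∀ t, MeasurableSpace.CountablyGenerated (Ω t)]

/-- A prior up to time `t` is continued up to time `T` by the kernels of the dominating prior, so
that domination passes to the marginals. -/
theorem absolutelyContinuous_prodMeasure {T : ℕ}
    {Q : (s : ℕ) → Hist Ω s → Set (ProbabilityMeasure (Ω s))}
    {q : (s : ℕ) → Hist Ω s → ProbabilityMeasure (Ω s)}
    (hq : ∀ s < T, IsUnivKernel (q s) ∧ ∀ ω, q s ω ∈ Q s ω)
    (hdom : ∀ P ∈ priors Q T, (P : Measure (Hist Ω T)) ≪ prodMeasure q T)
    {t : ℕ} (ht : t ≤ T) {P : ProbabilityMeasure (Hist Ω t)} (hP : P ∈ priors Q t) :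
    (P : Measure (Hist Ω t)) ≪ prodMeasure q t := by
  classical
  obtain ⟨r, hr, hPr⟩ := hP
  let r' : (s : ℕ) → Hist Ω s → ProbabilityMeasure (Ω s) := fun s => if s < t then r s else q s
  have hr' : ∀ s < T, IsUnivKernel (r' s) ∧ ∀ ω, r' s ω ∈ Q s ω := by
    intro s hs
    by_cases h : s < t
    · simpa [r', h] using hr s h
    · simpa [r', h] using hq s hs
  have hprob := isProbabilityMeasure_prodMeasure fun s hs => (hr' s hs).1
  have hac := hdom ⟨prodMeasure r' T, hprob⟩ ⟨r', hr', rfl⟩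
  have := hac.map (measurable_restrict ht)
  rw [map_restrict_prodMeasure ht fun s hs => (hq s hs).1, ProbabilityMeasure.coe_mk,
    map_restrict_prodMeasure ht fun s hs => (hr' s hs).1] at this
  rwa [hPr, prodMeasure_congr fun s hs => (if_pos hs).symm]

end Priors

/-! ### Conditional supports -/

section Support
variable {Y E : Type*} [MeasurableSpace Y] [TopologicalSpace E] [SecondCountableTopology E]
  [MeasurableSpace E] [OpensMeasurableSpace E]

/-- The common support of the image laws of `F` under the elements of `W` is the complement of the
union of the basic open sets that are null for all of them. -/
theorem mem_sInter_closed_iff {W : Set (ProbabilityMeasure Y)} {F : Y → E} (hF : Measurable F)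
    {x : E} :
    x ∈ ⋂₀ {A | IsClosed A ∧ ∀ p ∈ W, (p : Measure Y) {y | F y ∈ A} = 1} ↔
      ∀ U ∈ TopologicalSpace.countableBasis E, x ∈ U →
        ∃ p ∈ W, (p : Measure Y) {y | F y ∈ U} ≠ 0 := by
  have hB := TopologicalSpace.isBasis_countableBasis E
  constructor
  · intro hx U hU hxU
    by_contra! hn
    refine hx Uᶜ ⟨(hB.isOpen hU).isClosed_compl, fun p hp => ?_⟩ hxU
    exact (prob_compl_eq_one_iff (hF (hB.isOpen hU).measurableSet)).2 (hn p hp)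
  · rintro h A ⟨hA, hAp⟩
    by_contra hxA
    obtain ⟨U, hU, hxU, hUA⟩ := hB.exists_subset_of_mem_open (mem_compl hxA) hA.isOpen_compl
    obtain ⟨p, hp, hpU⟩ := h U hU hxU
    refine hpU (measure_mono_null (fun y hy => hUA hy) ?_)
    exact (prob_compl_eq_zero_iff (hF hA.measurableSet)).2 (hAp p hp)

theorem sInter_closed_eq_of_null {W : Set (ProbabilityMeasure Y)} {q : ProbabilityMeasure Y}
    (hqW : q ∈ W) {F : Y → E} (hF : Measurable F)
    (h : ∀ U ∈ TopologicalSpace.countableBasis E, (q : Measure Y) {y | F y ∈ U} = 0 →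
      ∀ p ∈ W, (p : Measure Y) {y | F y ∈ U} = 0) :
    ⋂₀ {A | IsClosed A ∧ (q : Measure Y) {y | F y ∈ A} = 1} =
      ⋂₀ {A | IsClosed A ∧ ∀ p ∈ W, (p : Measure Y) {y | F y ∈ A} = 1} := by
  ext x
  rw [mem_sInter_closed_iff hF]
  have h1 := mem_sInter_closed_iff (W := {q}) hF (x := x)
  simp only [mem_singleton_iff, forall_eq, exists_eq_left] at h1
  rw [h1]
  refine forall₂_congr fun U hU => imp_congr_right fun _ => ⟨fun hq => ⟨q, hqW, hq⟩, ?_⟩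
  rintro ⟨p, hp, hpU⟩ hq
  exact hpU (h U hU hq p hp)

/-- As `E` is second countable, the support carries full measure. -/
theorem ae_mem_sInter_closed (q : ProbabilityMeasure Y) {F : Y → E} (hF : Measurable F) :
    ∀ᵐ y ∂(q : Measure Y), F y ∈ ⋂₀ {A | IsClosed A ∧ (q : Measure Y) {y | F y ∈ A} = 1} := by
  have h1 := fun x => mem_sInter_closed_iff (W := {q}) hF (x := x)
  simp only [mem_singleton_iff, forall_eq, exists_eq_left] at h1
  simp only [h1]
  refine (ae_ball_iff (TopologicalSpace.countable_countableBasis E)).2 fun U hU => ?_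
  by_cases h0 : (q : Measure Y) {y | F y ∈ U} = 0
  · filter_upwards [measure_eq_zero_iff_ae_notMem.1 h0] with y hy hyU
    exact absurd hyU hy
  · exact Filter.Eventually.of_forall fun _ _ => h0

end Support

/-- One-period no-arbitrage under a single law puts `0` in the relative interior of the convex hull
of the support. -/
theorem zero_mem_intrinsicInterior_support {Y E : Type*} [MeasurableSpace Y]
    [NormedAddCommGroup E] [InnerProductSpace ℝ E] [FiniteDimensional ℝ E] [MeasurableSpace E]
    [BorelSpace E] (q : ProbabilityMeasure Y) {F : Y → E} (hF : Measurable F)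
    (h : ∀ ξ : E, (q : Measure Y) {y | ⟪ξ, F y⟫ < 0} = 0 → (q : Measure Y) {y | 0 < ⟪ξ, F y⟫} = 0) :
    0 ∈ intrinsicInterior ℝ
      (convexHull ℝ (⋂₀ {A | IsClosed A ∧ (q : Measure Y) {y | F y ∈ A} = 1})) := by
  have hD := ae_mem_sInter_closed q hF
  refine zero_mem_intrinsicInterior_convexHull ?_ fun ξ hξ x hx => ?_
  · obtain ⟨y, hy⟩ := hD.exists
    exact ⟨_, hy⟩
  · refine ((hξ x hx).eq_or_lt).elim Eq.symm fun hpos => ?_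
    have hneg : (q : Measure Y) {y | ⟪ξ, F y⟫ < 0} = 0 := by
      refine measure_eq_zero_iff_ae_notMem.2 ?_
      filter_upwards [hD] with y hyD hy
      exact absurd (hξ _ hyD) (not_le.2 hy)
    have hx' := (mem_sInter_closed_iff (W := {q}) hF (x := x)).1 (by simpa using hx)
    have hV : IsOpen {z : E | 0 < ⟪ξ, z⟫} :=
      isOpen_lt continuous_const (continuous_const.inner continuous_id)
    obtain ⟨U, hU, hxU, hUV⟩ :=
      (TopologicalSpace.isBasis_countableBasis E).exists_subset_of_mem_open hpos hV
    obtain ⟨p, rfl, hp⟩ := hx' U hU hxU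
    exact absurd (measure_mono_null (fun y (hy : F y ∈ U) => hUV hy) (h ξ hneg)) hp

/-! ### One-period consequences of domination and of no-arbitrage -/

/-- The σ-algebra carried by `ProbabilityMeasure Y` is generated by the evaluations; only one half
of its coincidence with the Borel σ-algebra of the weak topology is needed here. -/
theorem analyticSet_inter_measurableSet {X Y : Type*} [TopologicalSpace X] [MeasurableSpace X]
    [BorelSpace X] [TopologicalSpace Y] [PolishSpace Y] [MeasurableSpace Y] [BorelSpace Y]
    {A : Set (X × ProbabilityMeasure Y)} (hA : AnalyticSet A)
    {R : Set (X × ProbabilityMeasure Y)} (hR : MeasurableSet R) : AnalyticSet (A ∩ R) := by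
  rw [AnalyticSet] at hA
  obtain rfl | ⟨f, hf, rfl⟩ := hA
  · simpa using analyticSet_empty
  have h2 : Measurable fun α => ((f α).2 : Measure Y) := by
    let : MeasurableSpace (ProbabilityMeasure Y) := borel _
    have : BorelSpace (ProbabilityMeasure Y) := ⟨rfl⟩
    exact measurable_coe_probabilityMeasure_of_borel.comp (continuous_snd.comp hf).measurable
  have hfm : Measurable f := (continuous_fst.comp hf).measurable.prodMk h2.subtype_mk
  rw [inter_comm, ← image_preimage_eq_inter_range]
  exact (hfm hR).analyticSet.image_of_continuous hf

section OnePeriod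
variable {Ω : ℕ → Type*} [∀ t, TopologicalSpace (Ω t)] [∀ t, PolishSpace (Ω t)]
    [∀ t, MeasurableSpace (Ω t)] [∀ t, BorelSpace (Ω t)]

/-- If `P ⊗ q` dominates all `P ⊗ r` with `r` a selection of the one-period sets of priors, then
almost surely `q` does not charge a section of `B` only if no one-period prior does. Otherwise a
prior charging this section can be selected on a set of positive measure. -/
theorem ae_null_of_dominated {t : ℕ} (P : Measure (Hist Ω t)) [IsProbabilityMeasure P]
    {G : Hist Ω t → Set (ProbabilityMeasure (Ω t))}
    (hG : AnalyticSet {z : Hist Ω t × ProbabilityMeasure (Ω t) | z.2 ∈ G z.1})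
    {q : Hist Ω t → ProbabilityMeasure (Ω t)} (hq : IsUnivKernel q) (hqG : ∀ ω, q ω ∈ G ω)
    (hdom : ∀ r : Hist Ω t → ProbabilityMeasure (Ω t), IsUnivKernel r → (∀ ω, r ω ∈ G ω) →
      prodStep P r ≪ prodStep P q)
    {B : Set (Hist Ω (t + 1))} (hB : MeasurableSet B) :
    ∀ᵐ ω ∂P, (q ω : Measure (Ω t)) {y | append ω y ∈ B} = 0 →
      ∀ p ∈ G ω, (p : Measure (Ω t)) {y | append ω y ∈ B} = 0 := by
  classical
  obtain ⟨κ, hκ, hqκ⟩ := hq.exists_kernel P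
  let R : Set (Hist Ω t × ProbabilityMeasure (Ω t)) :=
    {z | κ z.1 {y | append z.1 y ∈ B} = 0 ∧ (z.2 : Measure (Ω t)) {y | append z.1 y ∈ B} ≠ 0}
  have hR : MeasurableSet R := by
    let η : ProbabilityTheory.Kernel (Hist Ω t × ProbabilityMeasure (Ω t)) (Ω t) :=
      ⟨fun z => z.2, measurable_subtype_coe.comp measurable_snd⟩
    have hη : ProbabilityTheory.IsMarkovKernel η :=
      ⟨fun z => inferInstanceAs (IsProbabilityMeasure (z.2 : Measure (Ω t)))⟩
    have h1 : Measurable fun z : Hist Ω t × ProbabilityMeasure (Ω t) =>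
        κ z.1 {y | append z.1 y ∈ B} :=
      (ProbabilityTheory.Kernel.measurable_kernel_prodMk_left (κ := κ)
        (measurable_append hB)).comp measurable_fst
    have h2 : Measurable fun z : Hist Ω t × ProbabilityMeasure (Ω t) =>
        η z {y | append z.1 y ∈ B} :=
      ProbabilityTheory.Kernel.measurable_kernel_prodMk_left (κ := η)
        ((measurable_append.comp ((measurable_fst.comp measurable_fst).prodMk measurable_snd)) hB)
    exact (h1 (measurableSet_singleton 0)).inter (h2 (measurableSet_singleton 0)).compl
  by_contra hn
  have hpos : P (Prod.fst '' ({z | z.2 ∈ G z.1} ∩ R)) ≠ 0 := by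
    intro h0
    refine hn ?_
    filter_upwards [hqκ, measure_eq_zero_iff_ae_notMem.1 h0] with ω hω hωn hnull p hp
    by_contra hpn
    exact hωn ⟨(ω, p), ⟨hp, by rw [← hω]; exact hnull, hpn⟩, rfl⟩
  obtain ⟨K, hK, hK0, σ, hσ, hσK⟩ :=
    exists_measurable_selection_of_analyticSet P (analyticSet_inter_measurableSet hG hR) hpos
  let r : Hist Ω t → ProbabilityMeasure (Ω t) := fun ω => if ω ∈ K then σ ω else q ω
  have hr : IsUnivKernel r := by
    have h1 : Measurable[univSigma (Hist Ω t)] fun ω => (σ ω : Measure (Ω t)) :=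
      (@Measurable.comp _ _ _ _ (borel _) _ _ _ measurable_coe_probabilityMeasure_of_borel
        hσ).mono le_univSigma le_rfl
    have h2 : (fun ω => (r ω : Measure (Ω t))) =
        fun ω => if ω ∈ K then (σ ω : Measure (Ω t)) else q ω := by
      funext ω
      by_cases h : ω ∈ K <;> simp [r, h]
    rw [IsUnivKernel, h2]
    exact Measurable.ite (le_univSigma K hK) h1 hq
  have hrG : ∀ ω, r ω ∈ G ω := by
    intro ω
    by_cases h : ω ∈ K
    · simpa [r, h] using (hσK ω h).1
    · simpa [r, h] using hqG ω
  -- the part of `B` above `K` is null for `P ⊗ q` but not for `P ⊗ r`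
  have hBK : MeasurableSet (B ∩ restrict t.le_succ ⁻¹' K) := hB.inter (measurable_restrict _ hK)
  have hres : ∀ ω (y : Ω t), restrict t.le_succ (append ω y) = ω :=
    fun ω y => restrict_append le_rfl ω y
  have hq0 : prodStep P q (B ∩ restrict t.le_succ ⁻¹' K) = 0 := by
    rw [prodStep_eq_zero_iff P hq hBK]
    filter_upwards [hqκ] with ω hω
    by_cases h : ω ∈ K
    · refine measure_mono_null (fun y hy => hy.1) ?_
      rw [hω]
      exact (hσK ω h).2.1
    · simp [hres, h]
  have hr0 := (prodStep_eq_zero_iff P hr hBK).1 (hdom r hr hrG hq0)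
  refine hK0 (measure_eq_zero_iff_ae_notMem.2 ?_)
  filter_upwards [hr0] with ω hω h
  refine (hσK ω h).2.2 ?_
  simpa [hres, h, r] using hω

/-- One-period no-arbitrage for Borel strategies entails the conditional no-arbitrage property for
almost every past: otherwise an arbitrage direction could be selected on a set of positive
measure. -/
theorem ae_noArbitrage_of_prodStep {t : ℕ} (P : Measure (Hist Ω t)) [IsProbabilityMeasure P]
    {q : Hist Ω t → ProbabilityMeasure (Ω t)} (hq : IsUnivKernel q)
    {E : Type*} [NormedAddCommGroup E] [InnerProductSpace ℝ E] [FiniteDimensional ℝ E]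
    [MeasurableSpace E] [BorelSpace E] {F : Hist Ω (t + 1) → E} (hF : Measurable F)
    (hNA : ∀ ξ : Hist Ω t → E, Measurable ξ →
      (∀ᵐ ω ∂prodStep P q, 0 ≤ ⟪ξ (restrict t.le_succ ω), F ω⟫) →
      ∀ᵐ ω ∂prodStep P q, ⟪ξ (restrict t.le_succ ω), F ω⟫ = 0) :
    ∀ᵐ ω ∂P, ∀ ξ : E, (q ω : Measure (Ω t)) {y | ⟪ξ, F (append ω y)⟫ < 0} = 0 →
      (q ω : Measure (Ω t)) {y | 0 < ⟪ξ, F (append ω y)⟫} = 0 := by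
  classical
  obtain ⟨κ, hκ, hqκ⟩ := hq.exists_kernel P
  let A : Set (Hist Ω t × E) :=
    {z | κ z.1 {y | ⟪z.2, F (append z.1 y)⟫ < 0} = 0 ∧ κ z.1 {y | 0 < ⟪z.2, F (append z.1 y)⟫} ≠ 0}
  have hA : MeasurableSet A := by
    let η : ProbabilityTheory.Kernel (Hist Ω t × E) (Ω t) := κ.comap Prod.fst measurable_fst
    have hi : Measurable fun w : (Hist Ω t × E) × Ω t => ⟪w.1.2, F (append w.1.1 w.2)⟫ :=
      (measurable_snd.comp measurable_fst).inner (hF.comp (measurable_append.comp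
        ((measurable_fst.comp measurable_fst).prodMk measurable_snd)))
    have h1 := ProbabilityTheory.Kernel.measurable_kernel_prodMk_left (κ := η)
      (measurableSet_lt hi measurable_const : MeasurableSet {w | _ < (0 : ℝ)})
    have h2 := ProbabilityTheory.Kernel.measurable_kernel_prodMk_left (κ := η)
      (measurableSet_lt measurable_const hi : MeasurableSet {w | (0 : ℝ) < _})
    exact (h1 (measurableSet_singleton 0)).inter (h2 (measurableSet_singleton 0)).compl
  by_contra hn
  have hpos : P (Prod.fst '' A) ≠ 0 := by
    intro h0
    refine hn ?_
    filter_upwards [hqκ, measure_eq_zero_iff_ae_notMem.1 h0] with ω hω hωn ξ hneg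
    by_contra hξ
    rw [hω] at hneg hξ
    exact hωn ⟨(ω, ξ), ⟨hneg, hξ⟩, rfl⟩
  have : CompleteSpace E := FiniteDimensional.complete ℝ E
  have : ProperSpace E := FiniteDimensional.proper ℝ E
  obtain ⟨K, hK, hK0, σ, hσ, hσK⟩ := exists_measurable_selection_of_analyticSet P hA.analyticSet hpos
  rw [← BorelSpace.measurable_eq] at hσ
  have hξ : Measurable fun ω => if ω ∈ K then σ ω else 0 := Measurable.ite hK hσ measurable_const
  have hm : Measurable fun ω : Hist Ω (t + 1) =>
      ⟪(fun ω => if ω ∈ K then σ ω else 0) (restrict t.le_succ ω), F ω⟫ :=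
    (hξ.comp (measurable_restrict _)).inner hF
  have hres : ∀ ω (y : Ω t), restrict t.le_succ (append ω y) = ω :=
    fun ω y => restrict_append le_rfl ω y
  have h0 := hNA _ hξ ?_
  · refine hK0 (measure_eq_zero_iff_ae_notMem.2 ?_)
    have h1 := (prodStep_eq_zero_iff P hq (measurableSet_eq_fun hm measurable_const).compl).1 h0
    filter_upwards [hqκ, h1] with ω hω h2 h
    refine (hσK ω h).2 ?_
    rw [← hω]
    refine measure_mono_null (fun y hy => ?_) h2
    have hy' : 0 < ⟪σ ω, F (append ω y)⟫ := hy
    simpa [hres, h] using hy'.ne'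
  · have h1 := prodStep_eq_zero_iff P hq (measurableSet_le (measurable_const (a := (0 : ℝ))) hm).compl
    refine h1.2 ?_
    filter_upwards [hqκ] with ω hω
    by_cases h : ω ∈ K
    · rw [hω]
      simpa [hres, h] using (hσK ω h).1
    · simp [hres, h]

end OnePeriod

/-! ### The multi-period market -/

section Multiperiod
variable {Ω : ℕ → Type*} [∀ t, MeasurableSpace (Ω t)]

/-- Trading in a single period turns no-arbitrage over the whole horizon into one-period
no-arbitrage. -/
theorem NoArbitrageFor.one_period {d T : ℕ}
    {S : (t : ℕ) → Hist Ω t → EuclideanSpace ℝ (Fin d)} {P : ProbabilityMeasure (Hist Ω T)}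
    (hNA : NoArbitrageFor S T P) {t : ℕ} (ht : t < T)
    {ξ : Hist Ω t → EuclideanSpace ℝ (Fin d)} (hξ : Measurable ξ)
    (h : ∀ᵐ ω ∂(P : Measure (Hist Ω T)),
      0 ≤ ⟪ξ (restrict ht.le ω), S (t + 1) (restrict ht ω) - S t (restrict ht.le ω)⟫) :
    ∀ᵐ ω ∂(P : Measure (Hist Ω T)),
      ⟪ξ (restrict ht.le ω), S (t + 1) (restrict ht ω) - S t (restrict ht.le ω)⟫ = 0 := by
  classical
  let φ : (s : ℕ) → Hist Ω s → EuclideanSpace ℝ (Fin d) := Function.update (fun _ _ => 0) t ξ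
  have hφ : IsStrategy T φ := by
    intro s _
    by_cases hs : s = t
    · subst hs
      simpa [φ] using hξ.mono le_univSigma le_rfl
    · simp only [φ, Function.update_of_ne hs]
      exact measurable_const
  have hw : ∀ ω, wealth S 0 φ T ω =
      ⟪ξ (restrict ht.le ω), S (t + 1) (restrict ht ω) - S t (restrict ht.le ω)⟫ := by
    intro ω
    rw [wealth, zero_add, Finset.sum_eq_single (⟨t, ht⟩ : Fin T)]
    · simp [φ]
    · intro s _ hs
      have : s.val ≠ t := fun h => hs (Fin.ext h)
      simp [φ, Function.update_of_ne this]
    · simp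
  have := hNA φ hφ
  simp only [hw] at this
  exact this h

/-- A prior dominating all the others, and itself one of them, has the same null sets as the
whole family; so the two no-arbitrage conditions coincide. -/
theorem noArbitrageFor_iff_of_dominating {d T : ℕ}
    {S : (t : ℕ) → Hist Ω t → EuclideanSpace ℝ (Fin d)} {W : Set (ProbabilityMeasure (Hist Ω T))}
    {P : ProbabilityMeasure (Hist Ω T)} (hP : P ∈ W)
    (hdom : ∀ P' ∈ W, (P' : Measure (Hist Ω T)) ≪ (P : Measure (Hist Ω T))) :
    NoArbitrageFor S T P ↔ NoArbitrage S T W := by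
  have key : ∀ p : Hist Ω T → Prop,
      QuasiSurely W p ↔ ∀ᵐ ω ∂(P : Measure (Hist Ω T)), p ω := fun p =>
    quasiSurely_iff_ae.trans ⟨fun h => h P hP, fun h P' hP' => (hdom P' hP').ae_le h⟩
  simp only [NoArbitrage, NoArbitrageFor, key]

end Multiperiod
end QuasiSure

theorem proposition3p18 {Ω : ℕ → Type*} [∀ t, TopologicalSpace (Ω t)] [∀ t, PolishSpace (Ω t)]
    [∀ t, MeasurableSpace (Ω t)] [∀ t, BorelSpace (Ω t)] {d : ℕ} (T : ℕ)
    -- the price process, adapted to the Borel filtration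
    (S : (t : ℕ) → QuasiSure.Hist Ω t → EuclideanSpace ℝ (Fin d))
    (hS : ∀ t ≤ T, Measurable (S t))
    -- the one-period sets of priors: non-empty, convex, with analytic graph
    (Q : (t : ℕ) → QuasiSure.Hist Ω t → Set (ProbabilityMeasure (Ω t)))
    (hQ_nonempty : ∀ t < T, ∀ ω, (Q t ω).Nonempty)
    (hQ_convex : ∀ t < T, ∀ ω,
      Convex NNReal ((fun p : ProbabilityMeasure (Ω t) => (p : Measure (Ω t))) '' Q t ω))
    (hQ_analytic : ∀ t < T, AnalyticSet
      {z : QuasiSure.Hist Ω t × ProbabilityMeasure (Ω t) | z.2 ∈ Q t z.1})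
    -- a dominating prior
    (Phat : ProbabilityMeasure (QuasiSure.Hist Ω T)) (hPhat : Phat ∈ QuasiSure.priors Q T)
    (hdom : ∀ P ∈ QuasiSure.priors Q T,
      (P : Measure (QuasiSure.Hist Ω T)) ≪ (Phat : Measure (QuasiSure.Hist Ω T))) :
    (QuasiSure.NoArbitrageFor S T Phat ↔
      QuasiSure.NoArbitrage S T (QuasiSure.priors Q T)) ∧
    (QuasiSure.NoArbitrage S T (QuasiSure.priors Q T) →
      -- any disintegration of the dominating prior by universally measurable kernels
      ∀ phat : (t : ℕ) → QuasiSure.Hist Ω t → ProbabilityMeasure (Ω t),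
        (∀ t < T, QuasiSure.IsUnivKernel (phat t)) →
        (Phat : Measure (QuasiSure.Hist Ω T)) = QuasiSure.prodMeasure phat T →
        ∀ t < T, QuasiSure.QuasiSurely (QuasiSure.priors Q t) fun ω =>
          QuasiSure.condSupportFor S phat t ω = QuasiSure.condSupport S Q t ω ∧
          0 ∈ intrinsicInterior ℝ (convexHull ℝ (QuasiSure.condSupportFor S phat t ω))) := by
  obtain ⟨q, hq, hPq⟩ := hPhat
  have hiff := QuasiSure.noArbitrageFor_iff_of_dominating (S := S) (P := Phat)
    (W := QuasiSure.priors Q T) ⟨q, hq, hPq⟩ hdom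
  refine ⟨hiff, fun hNA phat hphat hPphat t ht => ?_⟩
  have hNA' := hiff.2 hNA
  have hqu : ∀ s < T, QuasiSure.IsUnivKernel (q s) := fun s hs => (hq s hs).1
  have hdom' : ∀ s ≤ T, ∀ P ∈ QuasiSure.priors Q s,
      (P : Measure (QuasiSure.Hist Ω s)) ≪ QuasiSure.prodMeasure q s := fun s hs P hP =>
    QuasiSure.absolutelyContinuous_prodMeasure hq (by rwa [hPq] at hdom) hs hP
  have hprob : IsProbabilityMeasure (QuasiSure.prodMeasure q t) :=
    QuasiSure.isProbabilityMeasure_prodMeasure fun s hs => hqu s (hs.trans ht)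
  have hmarg : ∀ s ≤ T, QuasiSure.prodMeasure phat s = QuasiSure.prodMeasure q s := by
    intro s hs
    rw [← QuasiSure.map_restrict_prodMeasure hs hphat, ← hPphat, hPq,
      QuasiSure.map_restrict_prodMeasure hs hqu]
  have heq : ∀ᵐ ω ∂QuasiSure.prodMeasure q t, q t ω = phat t ω := by
    refine QuasiSure.ae_eq_of_prodStep_eq _ (hqu t ht) (hphat t ht) ?_
    have h := hmarg (t + 1) ht
    rw [QuasiSure.prodMeasure, QuasiSure.prodMeasure, hmarg t ht.le] at h
    exact h.symm
  have hF : Measurable fun ω : QuasiSure.Hist Ω (t + 1) =>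
      S (t + 1) ω - S t (QuasiSure.restrict t.le_succ ω) :=
    (hS (t + 1) ht).sub ((hS t ht.le).comp (QuasiSure.measurable_restrict _))
  have hincr : ∀ ω y, S (t + 1) (QuasiSure.append ω y) -
      S t (QuasiSure.restrict t.le_succ (QuasiSure.append ω y)) = QuasiSure.incr S t ω y :=
    fun ω y => congrArg (fun z => S (t + 1) (QuasiSure.append ω y) - S t z)
      (QuasiSure.restrict_append le_rfl ω y)
  have hFy : ∀ ω, Measurable (QuasiSure.incr S t ω) := fun ω =>
    ((hS (t + 1) ht).comp (QuasiSure.measurable_append_right ω)).sub measurable_const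
  have hnull : ∀ᵐ ω ∂QuasiSure.prodMeasure q t,
      ∀ U ∈ TopologicalSpace.countableBasis (EuclideanSpace ℝ (Fin d)),
        (q t ω : Measure (Ω t)) {y | QuasiSure.incr S t ω y ∈ U} = 0 →
          ∀ p ∈ Q t ω, (p : Measure (Ω t)) {y | QuasiSure.incr S t ω y ∈ U} = 0 := by
    refine (ae_ball_iff (TopologicalSpace.countable_countableBasis _)).2 fun U hU => ?_
    have h := QuasiSure.ae_null_of_dominated (QuasiSure.prodMeasure q t) (hQ_analytic t ht)
      (hqu t ht) (hq t ht).2 ?_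
      (hF ((TopologicalSpace.isBasis_countableBasis _).isOpen hU).measurableSet)
    · simpa only [mem_preimage, hincr] using h
    · -- a one-period selection `r`, appended to `q 0, …, q (t - 1)`, is a prior up to time `t + 1`
      classical
      intro r hr hrQ
      have hstep : QuasiSure.prodMeasure (Function.update q t r) (t + 1) =
          QuasiSure.prodStep (QuasiSure.prodMeasure q t) r := by
        rw [QuasiSure.prodMeasure, QuasiSure.prodMeasure_congr (q' := q)
          fun s hs => Function.update_of_ne hs.ne _ _, Function.update_self]
      have := QuasiSure.isProbabilityMeasure_prodStep (QuasiSure.prodMeasure q t) hr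
      refine hdom' (t + 1) ht ⟨_, this⟩ ⟨Function.update q t r, fun s hs => ?_, hstep.symm⟩
      obtain hs | rfl := Nat.lt_succ_iff_lt_or_eq.1 hs
      · rw [Function.update_of_ne hs.ne]
        exact hq s (hs.trans ht)
      · rw [Function.update_self]
        exact ⟨hr, hrQ⟩
  have harb : ∀ᵐ ω ∂QuasiSure.prodMeasure q t, ∀ ξ : EuclideanSpace ℝ (Fin d),
      (q t ω : Measure (Ω t)) {y | ⟪ξ, QuasiSure.incr S t ω y⟫ < 0} = 0 →
        (q t ω : Measure (Ω t)) {y | 0 < ⟪ξ, QuasiSure.incr S t ω y⟫} = 0 := by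
    have h := QuasiSure.ae_noArbitrage_of_prodStep (QuasiSure.prodMeasure q t) (hqu t ht) hF ?_
    · simpa only [hincr] using h
    · intro ξ hξ h
      have hmap : QuasiSure.prodStep (QuasiSure.prodMeasure q t) (q t) =
          (Phat : Measure (QuasiSure.Hist Ω T)).map (QuasiSure.restrict ht) := by
        rw [hPq, QuasiSure.map_restrict_prodMeasure ht hqu, QuasiSure.prodMeasure]
      have hm : Measurable fun ω : QuasiSure.Hist Ω (t + 1) =>
          ⟪ξ (QuasiSure.restrict t.le_succ ω),
            S (t + 1) ω - S t (QuasiSure.restrict t.le_succ ω)⟫ :=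
        (hξ.comp (QuasiSure.measurable_restrict t.le_succ)).inner hF
      have hr := (QuasiSure.measurable_restrict (Ω := Ω) ht).aemeasurable
        (μ := (Phat : Measure (QuasiSure.Hist Ω T)))
      rw [hmap] at h ⊢
      rw [ae_map_iff hr (measurableSet_le measurable_const hm)] at h
      rw [ae_map_iff hr (measurableSet_eq_fun hm measurable_const)]
      exact hNA'.one_period ht hξ h
  refine QuasiSure.quasiSurely_iff_ae.2 fun P hP => (hdom' t ht.le P hP).ae_le ?_
  filter_upwards [heq, hnull, harb] with ω h1 h2 h3
  have hsupp : QuasiSure.condSupportFor S phat t ω =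
      ⋂₀ {A | IsClosed A ∧ (q t ω : Measure (Ω t)) {y | QuasiSure.incr S t ω y ∈ A} = 1} := by
    rw [QuasiSure.condSupportFor, ← h1]
  rw [hsupp]
  exact ⟨QuasiSure.sInter_closed_eq_of_null ((hq t ht).2 ω) (hFy ω) h2,
    QuasiSure.zero_mem_intrinsicInterior_support (q t ω) (hFy ω) h3⟩
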